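/- Let $\mathcal I$ be a generalised inverse category: a category with a function $\deg\colon \mathrm{ob}\,\mathcal I\to\mathbb N$ such that $\deg i>\deg j$ whenever there is a non-isomorphism $i\to j$, and $\deg i=\deg j$ whenever $i\cong j$. For $n\in\mathbb N$ let $\mathcal I_{<n}$ and $\mathcal I_{\le n}$ be the full subcategories on the objects of degree $<n$ and $\le n$, and let $\mathbb G_n(\mathcal I)$ be the groupoid of objects of degree exactly $n$ and isomorphisms between them. Let $\mathcal E$ be a category such that for each $n$ and each $i\in\mathbb G_n(\mathcal I)$ all limits indexed by the category of elements of $\mathcal I(i,-)\colon\mathcal I_{<n}\to\mathbf{Set}$ exist in $\mathcal E$. Then restriction $\mathcal E^{\mathcal I_{\le n}}\to\mathcal E^{\mathcal I_{<n}}$ has a right adjoint $\mathrm{cosk}_n$, the right Kan extension. For $X\in\mathcal E^{\mathcal I}$ and $i\in\mathcal I$ of degree $n$, put $M_iX=(\mathrm{cosk}_n(X|_{\mathcal I_{<n}}))(i)$, and let the matching map $m_iX\colon Xi\to M_iX$ be the component at $i$ of the unit of this adjunction at $X|_{\mathcal I_{\le n}}$. Assume that each $\mathbb G_n(\mathcal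 I)$ is connected (or empty), or that $\mathcal E$ has an initial object. If $\mathcal E$ has all finite limits and a subobject classifier $\mathrm{true}_{\mathcal E}\colon 1_{\mathcal E}\to\Omega_{\mathcal E}$, then $\mathcal E^{\mathcal I}$ has a subobject classifier $\mathrm{true}\colon 1\to\Omega$ such that for each $i\in\mathcal I$ there is an equaliser $$\Omega i\xrightarrow{\;e_i\;}\Omega_{\mathcal E}\times M_i\Omega\rightrightarrows\Omega_{\mathcal E}$$ of the two maps $\pi_1$ and $\wedge\circ(\mathrm{id}\times\chi_{M_i(\mathrm{true})})$. Here $\wedge\colon\Omega_{\mathcal E}\times\Omega_{\mathcal E}\to\Omega_{\mathcal E}$ is the characteristic map of $(\mathrm{true}_{\mathcal E},\mathrm{true}_{\mathcal E})$, and $\chi_{M_i(\mathrm{true})}\colon M_i\Omega\to\Omega_{\mathcal E}$ is the characteristic map of the monomorphism $M_i(\mathrm{true})\colon 1_{\mathcal E}\cong M_i1\hookrightarrow M_i\Omega$. Moreover $\pi_2\circ e_i=m_i\Omega$, and the component $\mathrm{true}_i\colon 1_{\mathcal E}\cong 1i\to\Omega i$ satisfies $\pi_1\circ e_i\circ\mathrm{true}_i=\mathrm{true}_{\mathcal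 E}$ and $\pi_2\circ e_i\circ\mathrm{true}_i=M_i(\mathrm{true})$. -/

import Mathlib

open CategoryTheory CategoryTheory.Limits

universe v₁ v₂ u₁ u₂

/-- A generalised inverse structure on a category: a degree function on the objects, with values
in the natural numbers, such that maps that are not isomorphisms strictly lower the degree and
isomorphisms preserve it. -/
structure GenInverseStructure (I : Type u₁) [Category.{v₁} I] where
  /-- The degree of an object. -/
  deg : I → ℕ
  deg_lt_of_not_isIso : ∀ {i j : I} (f : i ⟶ j), ¬ IsIso f → deg j < deg i
  deg_eq_of_isIso : ∀ {i j : I} (f : i ⟶ j), IsIso f → deg i = deg j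

namespace GenInverseStructure

variable {I : Type u₁} [Category.{v₁} I] (D : GenInverseStructure I)

/-- The objects of degree strictly below `n`. -/
def degLT (n : ℕ) : ObjectProperty I := fun i => D.deg i < n

/-- The objects of degree at most `n`. -/
def degLE (n : ℕ) : ObjectProperty I := fun i => D.deg i ≤ n

/-- The objects of degree exactly `n`. -/
def degEQ (n : ℕ) : ObjectProperty I := fun i => D.deg i = n

/-- `I_{<n}`, the full subcategory on the objects of degree strictly below `n`. -/
abbrev StageLT (n : ℕ) := (D.degLT n).FullSubcategory

/-- `I_{≤n}`, the full subcategory on the objects of degree at most `n`. -/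
abbrev StageLE (n : ℕ) := (D.degLE n).FullSubcategory

/-- `G_n(I)`, the groupoid of the objects of degree exactly `n` and the isomorphisms of `I`
between them. -/
abbrev Stratum (n : ℕ) := Core (D.degEQ n).FullSubcategory

/-- The inclusion of `I_{<n}` into `I_{≤n}`. -/
abbrev inclLT (n : ℕ) : D.StageLT n ⥤ D.StageLE n :=
  ObjectProperty.ιOfLE fun _ h => le_of_lt h

/-- The inclusion `t_n` of `G_n(I)` into `I_{≤n}`. -/
abbrev inclStratum (n : ℕ) : D.Stratum n ⥤ D.StageLE n :=
  Core.inclusion _ ⋙ ObjectProperty.ιOfLE fun _ h => le_of_eq h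

/-- The object `i`, regarded as an object of the groupoid of its own degree. -/
def toStratum (i : I) : D.Stratum (D.deg i) := ⟨⟨i, rfl⟩⟩

/-- The indexing category of the matching limit at an object `i` of degree `n`. Its objects are the
maps of `I` from `i` to objects `j` of degree strictly below `n`, and its morphisms are the
commuting triangles under `i`; this is the category of elements of the functor `j ↦ I(i, j)` on
`I_{<n}`. -/
abbrev MatchingShape {n : ℕ} (i : D.Stratum n) :=
  StructuredArrow ((D.inclStratum n).obj i) (D.inclLT n)

/-- The category `E` has all the limits that are used in forming matching objects. -/
class HasMatchingLimits (E : Type u₂) [Category.{v₂} E] : Prop where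
  hasLimitsOfShape : ∀ (n : ℕ) (i : D.Stratum n), HasLimitsOfShape (D.MatchingShape i) E

section Matching

variable {E : Type u₂} [Category.{v₂} E] [D.HasMatchingLimits E]

/-- Right Kan extensions along `I_{<n} ⥤ I_{≤n}` exist, and are pointwise: at an object of
degree `n` one takes a matching limit, at an object of lower degree nothing changes. -/
instance hasPointwiseRightKanExtension_inclLT (n : ℕ) (F : D.StageLT n ⥤ E) :
    (D.inclLT n).HasPointwiseRightKanExtension F := by
  rintro ⟨i, hi⟩
  rcases Nat.lt_or_eq_of_le hi with h | h
  · have : (D.inclLT n).Full := ObjectProperty.full_ιOfLE _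
    have : (D.inclLT n).Faithful := ObjectProperty.faithful_ιOfLE _
    have : HasInitial (StructuredArrow (⟨i, hi⟩ : D.StageLE n) (D.inclLT n)) :=
      (StructuredArrow.mkIdInitial (T := D.inclLT n) (Y := (⟨i, h⟩ : D.StageLT n))).hasInitial
    exact hasLimit_of_domain_hasInitial
  · have := HasMatchingLimits.hasLimitsOfShape (D := D) (E := E) n ⟨⟨i, h⟩⟩
    exact this.has_limit _

variable (E)

/-- The restriction of diagrams from `I` to `I_{≤n}`. -/
abbrev restrictLE (n : ℕ) : (I ⥤ E) ⥤ (D.StageLE n ⥤ E) :=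
  (Functor.whiskeringLeft _ _ E).obj (D.degLE n).ι

/-- The restriction of diagrams from `I_{≤n}` to `I_{<n}`. -/
abbrev res (n : ℕ) : (D.StageLE n ⥤ E) ⥤ (D.StageLT n ⥤ E) :=
  (Functor.whiskeringLeft _ _ E).obj (D.inclLT n)

/-- The restriction of diagrams from `I_{≤n}` to `G_n(I)`. -/
abbrev restrictStratum (n : ℕ) : (D.StageLE n ⥤ E) ⥤ (D.Stratum n ⥤ E) :=
  (Functor.whiskeringLeft _ _ E).obj (D.inclStratum n)

/-- The `n`-th coskeleton functor, the right Kan extension along `I_{<n} ⥤ I_{≤n}`. -/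
noncomputable abbrev cosk (n : ℕ) : (D.StageLT n ⥤ E) ⥤ (D.StageLE n ⥤ E) :=
  (D.inclLT n).ran

/-- The `n`-th matching object functor `M_n`. -/
noncomputable abbrev matchingFunctor (n : ℕ) : (D.StageLT n ⥤ E) ⥤ (D.Stratum n ⥤ E) :=
  D.cosk E n ⋙ D.restrictStratum E n

/-- The `n`-th matching map `m_n`, obtained from the unit of the adjunction between restriction
and coskeleton. -/
noncomputable def matchingNatTrans (n : ℕ) :
    D.restrictStratum E n ⟶ D.res E n ⋙ D.matchingFunctor E n :=
  Functor.whiskerRight ((D.inclLT n).ranAdjunction E).unit (D.restrictStratum E n)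

/-- The matching object `M_i X` of a diagram `X` at `i`, as a functor of `X`. -/
noncomputable def matchingObj (i : I) : (I ⥤ E) ⥤ E :=
  D.restrictLE E (D.deg i) ⋙ D.res E (D.deg i) ⋙ D.matchingFunctor E (D.deg i) ⋙
    (evaluation _ E).obj (D.toStratum i)

variable {E}

/-- The matching map `m_i X : X i ⟶ M_i X` of a diagram `X` at `i`. -/
noncomputable def matchingMap (X : I ⥤ E) (i : I) : X.obj i ⟶ (D.matchingObj E i).obj X :=
  ((D.matchingNatTrans E (D.deg i)).app ((D.restrictLE E (D.deg i)).obj X)).app (D.toStratum i)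

/-- The matching object functor at `i` preserves terminal objects. -/
noncomputable def isTerminalMatchingObj [HasTerminal E] (i : I) {T : I ⥤ E} (hT : IsTerminal T) :
    IsTerminal ((D.matchingObj E i).obj T) := by
  have h : PreservesLimitsOfShape (Discrete PEmpty.{1}) (D.cosk E (D.deg i)) :=
    ((D.inclLT (D.deg i)).ranAdjunction E).rightAdjoint_preservesLimits.preservesLimitsOfShape
  exact (IsTerminal.isTerminalObj ((evaluation _ E).obj (D.toStratum i)) _
    (IsTerminal.isTerminalObj (D.restrictStratum E _) _
      (IsTerminal.isTerminalObj (D.cosk E _) _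
        (IsTerminal.isTerminalObj (D.res E _) _
          (IsTerminal.isTerminalObj (D.restrictLE E _) _ hT)))))

end Matching

end GenInverseStructure

namespace InverseDiagram

open GenInverseStructure

variable {I : Type u₁} [Category.{v₁} I] (D : GenInverseStructure I)
  {E : Type u₂} [Category.{v₂} E]

/-- Any map out of the domain of the truth map is a monomorphism, as that domain is terminal. -/
instance mono_of_classifier (c : Subobject.Classifier E) {X : E} (f : c.Ω₀ ⟶ X) : Mono f :=
  c.isTerminalΩ₀.mono_from f

/-- The conjunction `∧ : Ω × Ω ⟶ Ω`, the characteristic map of `(true, true)`. -/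
noncomputable def meet [HasBinaryProducts E] (c : Subobject.Classifier E) : c.Ω ⨯ c.Ω ⟶ c.Ω :=
  c.χ (prod.lift c.truth c.truth)

variable [HasTerminal E]

/-- The component `true_i : 1 ⟶ Ω i` of the truth map of a subobject classifier of diagrams, with
the chosen terminal object `c.Ω₀` of `E` as its domain. -/
noncomputable def truthAt (c : Subobject.Classifier E) (d : Subobject.Classifier (I ⥤ E)) (i : I) :
    c.Ω₀ ⟶ d.Ω.obj i :=
  (IsTerminal.isTerminalObj ((evaluation I E).obj i) _ d.isTerminalΩ₀).from c.Ω₀ ≫ d.truth.app i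

/-- The map `M_i(true) : 1 ≅ M_i 1 ⟶ M_i Ω`. -/
noncomputable def matchingTruth [D.HasMatchingLimits E] (c : Subobject.Classifier E)
    (d : Subobject.Classifier (I ⥤ E)) (i : I) : c.Ω₀ ⟶ (D.matchingObj E i).obj d.Ω :=
  (D.isTerminalMatchingObj i d.isTerminalΩ₀).from c.Ω₀ ≫ (D.matchingObj E i).map d.truth

end InverseDiagram

/-! In sets, `Ω i` is the set of cosieves on `i`. Internally to `E`, a cosieve on `i` parametrised
by `A` is a `MonotoneFamily`: a truth value on `A` for each map out of `i`, growing along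
composition. The object `Ω i` is the one representing these families.

Representing objects are built by induction on the degree. The matching limit of the lower ones
represents families on the degree-lowering maps (`universalFamilyOfIsLimit`). All other maps out of
`i` are isomorphisms, where the value must agree with that at `𝟙 i`. So a full family is a truth
value `u` with a family on the lowering maps, such that `u` entails every member. As `M_i(true)`
classifies the constantly true family, this says that `u` entails `χ_{M_i(true)}` (`entails_χ_iff`),
that is, `u = u ∧ χ_{M_i(true)}`: the stated equaliser (`isLimitPairing`).

A subdiagram `m : U ⟶ X` is classified by the families `f ↦ X.map f ≫ χ (m.app j)`; values at
identities determine everything by naturality (`omegaχ_uniq`). -/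

namespace CategoryTheory.Subobject.Classifier

/-! ### Entailment of truth values, tested on generalised elements. -/

variable {C : Type u₂} [Category.{v₂} C] (c : Subobject.Classifier C)

/-- The map `A ⟶ Ω` that is constantly true. -/
def top (A : C) : A ⟶ c.Ω := c.χ₀ A ≫ c.truth

@[simp]
lemma comp_top {A B : C} (h : B ⟶ A) : h ≫ c.top A = c.top B := by
  simp only [top, ← Category.assoc]
  congr 1
  exact Subsingleton.elim _ _

lemma comp_truth {A : C} (h : A ⟶ c.Ω₀) : h ≫ c.truth = c.top A := by
  rw [top]
  congr 1
  exact Subsingleton.elim _ _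

lemma top_Ω₀ : c.top c.Ω₀ = c.truth := by
  rw [← c.comp_truth (𝟙 _), Category.id_comp]

lemma comp_χ_eq_top_iff {U X B : C} (m : U ⟶ X) [Mono m] (h : B ⟶ X) :
    h ≫ c.χ m = c.top B ↔ ∃ l : B ⟶ U, l ≫ m = h := by
  constructor
  · intro w
    exact ⟨(c.isPullback m).lift h (c.χ₀ B) w, (c.isPullback m).lift_fst _ _ _⟩
  · rintro ⟨l, rfl⟩
    rw [Category.assoc, (c.isPullback m).w, ← Category.assoc, comp_truth]

/-- The map `s` entails the map `t` if `t` is true wherever `s` is. -/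
def Entails {A : C} (s t : A ⟶ c.Ω) : Prop :=
  ∀ ⦃B : C⦄ (h : B ⟶ A), h ≫ s = c.top B → h ≫ t = c.top B

variable {c}

lemma Entails.refl {A : C} (s : A ⟶ c.Ω) : c.Entails s s := fun _ _ hs => hs

lemma Entails.precomp {A A' : C} {s t : A ⟶ c.Ω} (hst : c.Entails s t) (a : A' ⟶ A) :
    c.Entails (a ≫ s) (a ≫ t) := by
  intro B h hs
  rw [← Category.assoc] at hs ⊢
  exact hst _ hs

/-- Since `m` is mono and `T` is terminal, uniqueness of the lift and its second triangle are
automatic. -/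
lemma isPullback_of_isTerminal {U X T W : C} {m : U ⟶ X} [Mono m] {k : U ⟶ T}
    (hT : IsTerminal T) {x : X ⟶ W} {t : T ⟶ W} (w : m ≫ x = k ≫ t)
    (H : ∀ ⦃B : C⦄ (h : B ⟶ X), h ≫ x = hT.from B ≫ t → ∃ l : B ⟶ U, l ≫ m = h) :
    IsPullback m k x t := by
  have H' (s : PullbackCone x t) : ∃ l : s.pt ⟶ U, l ≫ m = s.fst :=
    H s.fst (by rw [s.condition, hT.hom_ext s.snd (hT.from _)])
  choose l hl using H'
  exact ⟨⟨w⟩, ⟨PullbackCone.IsLimit.mk w l hl (fun _ => hT.hom_ext _ _)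
    fun s a ha _ => by rw [← cancel_mono m, ha, hl]⟩⟩

/-- If `t` classifies `m`, then `s`, being true on the same generalised elements, classifies `m`
too. -/
lemma Entails.antisymm [HasPullbacks C] {A : C} {s t : A ⟶ c.Ω} (hst : c.Entails s t)
    (hts : c.Entails t s) : s = t := by
  obtain ⟨U, m, hm, rfl⟩ := c.surjective_χ t
  refine c.uniq m (χ₀' := c.χ₀ U) (isPullback_of_isTerminal c.isTerminalΩ₀ ?_ fun B h w => ?_)
  · exact hts m ((c.comp_χ_eq_top_iff m m).2 ⟨𝟙 _, Category.id_comp _⟩)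
  · exact (c.comp_χ_eq_top_iff m h).1 (hst h w)

lemma comp_meet_eq_top_iff [HasBinaryProducts C] {B : C} (h : B ⟶ c.Ω ⨯ c.Ω) :
    h ≫ InverseDiagram.meet c = c.top B ↔
      h ≫ prod.fst = c.top B ∧ h ≫ prod.snd = c.top B := by
  rw [InverseDiagram.meet, comp_χ_eq_top_iff]
  constructor
  · rintro ⟨l, rfl⟩
    simp [comp_truth, prod.lift_fst, prod.lift_snd]
  · rintro ⟨h₁, h₂⟩
    refine ⟨c.χ₀ B, ?_⟩
    ext <;> simp [comp_truth, prod.lift_fst, prod.lift_snd, h₁, h₂]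

/-- A map is fixed by meeting it with another one if and only if it entails that other one. -/
lemma eq_comp_meet_iff [HasBinaryProducts C] [HasPullbacks C] {A M : C} (a : A ⟶ c.Ω ⨯ M)
    (k : M ⟶ c.Ω) :
    a ≫ prod.fst = a ≫ prod.map (𝟙 c.Ω) k ≫ InverseDiagram.meet c ↔
      c.Entails (a ≫ prod.fst) (a ≫ prod.snd ≫ k) := by
  have key {B : C} (h : B ⟶ A) :
      h ≫ a ≫ prod.map (𝟙 c.Ω) k ≫ InverseDiagram.meet c = c.top B ↔
        h ≫ a ≫ prod.fst = c.top B ∧ h ≫ a ≫ prod.snd ≫ k = c.top B := by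
    have := comp_meet_eq_top_iff (c := c) (h ≫ a ≫ prod.map (𝟙 c.Ω) k)
    simpa using this
  constructor
  · intro w B h hs
    rw [w] at hs
    exact ((key h).1 hs).2
  · intro w
    exact Entails.antisymm (fun B h hs => (key h).2 ⟨hs, w h hs⟩) fun B h hs => ((key h).1 hs).1

end CategoryTheory.Subobject.Classifier

/-! ### Monotone families and the objects representing them. -/

namespace InverseDiagram

variable {I : Type u₁} [Category.{v₁} I] {E : Type u₂} [Category.{v₂} E]
  (c : Subobject.Classifier E)

/-- A monotone family of truth values on `A`, indexed by the maps from `i` to objects in `P`. If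
`E` is the category of sets, then this is a family of cosieves on `i`, parametrised by `A`. -/
@[ext]
structure MonotoneFamily (P : ObjectProperty I) (i : I) (A : E) where
  /-- The member of the family at a map out of `i`. -/
  val : ∀ {j : I}, (i ⟶ j) → P j → (A ⟶ c.Ω)
  entails : ∀ {j k : I} (f : i ⟶ j) (g : j ⟶ k) (hj : P j) (hk : P k),
    c.Entails (val f hj) (val (f ≫ g) hk)

variable {c} {P : ObjectProperty I} {i : I} {A : E}

namespace MonotoneFamily

lemma val_congr (s : MonotoneFamily c P i A) {j : I} {f g : i ⟶ j} (h : f = g) (hj : P j) :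
    s.val f hj = s.val g hj := by rw [h]

/-- The family induced by a map of parameters. -/
@[simps]
def precomp (s : MonotoneFamily c P i A) {B : E} (a : B ⟶ A) : MonotoneFamily c P i B where
  val f hj := a ≫ s.val f hj
  entails f g hj hk := (s.entails f g hj hk).precomp a

/-- The family induced by a map of base objects. -/
@[simps]
def push (s : MonotoneFamily c P i A) {i' : I} (g : i ⟶ i') : MonotoneFamily c P i' A where
  val f hj := s.val (g ≫ f) hj
  entails f f' hj hk := by simpa using s.entails (g ≫ f) f' hj hk

/-- The restriction of a family to a smaller class of objects. -/
@[simps]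
def restrict (s : MonotoneFamily c ⊤ i A) (P : ObjectProperty I) : MonotoneFamily c P i A where
  val f _ := s.val f trivial
  entails f g _ _ := s.entails f g trivial trivial

variable (c P i A) in
/-- The family that is constantly true. -/
@[simps]
def top : MonotoneFamily c P i A where
  val _ _ := c.top A
  entails _ _ _ _ := Subobject.Classifier.Entails.refl _

lemma entails_id (s : MonotoneFamily c ⊤ i A) {j : I} (f : i ⟶ j) :
    c.Entails (s.val (𝟙 i) trivial) (s.val f trivial) := by
  simpa using s.entails (𝟙 i) f trivial trivial

/-- Composing `f` with its inverse leads back to `𝟙 i`, so monotonicity applies in both directions.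
-/
lemma val_eq_of_isIso [HasPullbacks E] (s : MonotoneFamily c ⊤ i A) {j : I} (f : i ⟶ j)
    [IsIso f] : s.val f trivial = s.val (𝟙 i) trivial :=
  Subobject.Classifier.Entails.antisymm (by simpa using s.entails f (inv f) trivial trivial) (s.entails_id f)

end MonotoneFamily

variable (c P i) in
/-- A universal monotone family with parameter object `W`; it exhibits `W` as representing the
functor that sends `A` to the monotone families on `A`. -/
structure UniversalFamily (W : E) extends MonotoneFamily c P i W where
  /-- The classifying map of a monotone family. -/
  lift : ∀ {A : E}, MonotoneFamily c P i A → (A ⟶ W)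
  fac : ∀ {A : E} (s : MonotoneFamily c P i A) {j : I} (f : i ⟶ j) (hj : P j),
    lift s ≫ val f hj = s.val f hj
  hom_ext : ∀ {A : E} {a b : A ⟶ W},
    (∀ {j : I} (f : i ⟶ j) (hj : P j), a ≫ val f hj = b ≫ val f hj) → a = b

namespace UniversalFamily

variable {J : Type*} [Category J] (K : J ⥤ I) {W : J → E}
  (R : ∀ x, UniversalFamily c ⊤ (K.obj x) (W x))

/-- Parameter objects of universal families form a diagram. -/
@[simps]
def diagram : J ⥤ E where
  obj := W
  map {x y} φ := (R y).lift ((R x).push (K.map φ))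
  map_id x := (R x).hom_ext fun f hj => by
    rw [(R x).fac, MonotoneFamily.push_val, Category.id_comp]
    exact (R x).val_congr (by simp) hj
  map_comp {x y z} φ ψ := (R z).hom_ext fun f hj => by
    rw [Category.assoc, (R z).fac, (R z).fac]
    simp only [MonotoneFamily.push_val]
    rw [(R y).fac]
    exact (R x).val_congr (by simp) hj

lemma diagram_map_val {x y : J} (φ : x ⟶ y) {k : I} (f : K.obj y ⟶ k) :
    (diagram K R).map φ ≫ (R y).val f trivial = (R x).val (K.map φ ≫ f) trivial :=
  (R y).fac _ _ _

end UniversalFamily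

end InverseDiagram

/-! ### Degrees and the indices of the matching limit. -/

namespace GenInverseStructure

variable {I : Type u₁} [Category.{v₁} I] (D : GenInverseStructure I)

lemma deg_le {i j : I} (f : i ⟶ j) : D.deg j ≤ D.deg i := by
  by_cases hf : IsIso f
  · exact (D.deg_eq_of_isIso f hf).ge
  · exact (D.deg_lt_of_not_isIso f hf).le

lemma not_degLT_self (i : I) : ¬ D.degLT (D.deg i) i := lt_irrefl _

lemma isIso_of_deg_le {i j : I} (f : i ⟶ j) (h : D.deg i ≤ D.deg j) : IsIso f := by
  by_contra hf
  exact absurd (D.deg_lt_of_not_isIso f hf) h.not_gt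

/-- A map from `i` to an object of smaller degree, as an index of the matching limit. -/
def matchingIndex {i j : I} (f : i ⟶ j) (hj : D.degLT (D.deg i) j) :
    D.MatchingShape (D.toStratum i) :=
  let Y : D.StageLT (D.deg i) := ⟨j, hj⟩
  let g : (D.inclStratum (D.deg i)).obj (D.toStratum i) ⟶ (D.inclLT (D.deg i)).obj Y :=
    InducedCategory.Hom.mk f
  StructuredArrow.mk g

/-- The map out of `i` that underlies an index of the matching limit. -/
def matchingArrow {i : I} (x : D.MatchingShape (D.toStratum i)) : i ⟶ x.right.obj := x.hom.hom

/-- A map between codomains, as a map of indices of the matching limit. -/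
def matchingIndexHom {i : I} (x : D.MatchingShape (D.toStratum i)) {j : I} (f : x.right.obj ⟶ j)
    (hj : D.degLT (D.deg i) j) : x ⟶ D.matchingIndex (D.matchingArrow x ≫ f) hj :=
  StructuredArrow.homMk (InducedCategory.Hom.mk f) (ObjectProperty.hom_ext _ rfl)

lemma matchingArrow_comp {i : I} {x y : D.MatchingShape (D.toStratum i)} (φ : x ⟶ y) :
    D.matchingArrow x ≫ φ.right.hom = D.matchingArrow y :=
  congrArg (fun g => g.hom) (StructuredArrow.w φ)

lemma deg_right_lt {i : I} (x : D.MatchingShape (D.toStratum i)) : D.degLT (D.deg i) x.right.obj :=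
  x.right.property

end GenInverseStructure

namespace InverseDiagram

open GenInverseStructure

variable {I : Type u₁} [Category.{v₁} I] {D : GenInverseStructure I}
  {E : Type u₂} [Category.{v₂} E] {c : Subobject.Classifier E}

namespace MonotoneFamily

/-- A family on the maps to objects of degree below `n` induces a full family at each such
object. -/
@[simps]
def pushLT {n : ℕ} {i i' : I} {A : E} (s : MonotoneFamily c (D.degLT n) i A) (g : i ⟶ i')
    (hi' : D.degLT n i') : MonotoneFamily c ⊤ i' A where
  val f _ := s.val (g ≫ f) ((D.deg_le f).trans_lt hi')
  entails {j k} f f' _ _ := by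
    have h := s.entails (g ≫ f) f' ((D.deg_le f).trans_lt hi')
      ((D.deg_le (f ≫ f')).trans_lt hi')
    simpa using h

open scoped Classical in
/-- The full family at `i` that is a given family on the maps that lower the degree, and a given
truth value on the other ones. -/
@[simps]
noncomputable def extend {i : I} {A : E} (u : A ⟶ c.Ω) (s : MonotoneFamily c (D.degLT (D.deg i)) i A)
    (hu : ∀ {j : I} (f : i ⟶ j) (hj : D.degLT (D.deg i) j), c.Entails u (s.val f hj)) :
    MonotoneFamily c ⊤ i A where
  val {j} f _ := if hj : D.degLT (D.deg i) j then s.val f hj else u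
  entails {j k} f g _ _ := by
    by_cases hk : D.degLT (D.deg i) k
    · by_cases hj : D.degLT (D.deg i) j
      · simpa [hj, hk] using s.entails f g hj hk
      · simpa [hj, hk] using hu (f ≫ g) hk
    -- If the composite does not lower the degree, neither does `f`, so both values are `u`.
    · have hj : ¬ D.degLT (D.deg i) j := fun hj => hk ((D.deg_le g).trans_lt hj)
      simpa [hj, hk] using Subobject.Classifier.Entails.refl u

end MonotoneFamily

/-! ### Matching limits represent families on the degree-lowering maps. -/

section Limit

variable {i : I} {F : D.MatchingShape (D.toStratum i) ⥤ E}
  (R : ∀ x, UniversalFamily c ⊤ x.right.obj (F.obj x))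
  (hF : ∀ {x y} (φ : x ⟶ y) {k : I} (f : y.right.obj ⟶ k),
    F.map φ ≫ (R y).val f trivial = (R x).val (φ.right.hom ≫ f) trivial)

include hF in
-- Every value of a cone component is the identity value of another component, so recording identity
-- values alone loses nothing.
lemma cone_π_val (t : Cone F) (x : D.MatchingShape (D.toStratum i)) {k : I}
    (f : x.right.obj ⟶ k) (hk : D.degLT (D.deg i) k) :
    t.π.app (D.matchingIndex (D.matchingArrow x ≫ f) hk) ≫ (R _).val (𝟙 _) trivial =
      t.π.app x ≫ (R x).val f trivial := by
  rw [← t.w (D.matchingIndexHom x f hk), Category.assoc, hF]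
  congr 1
  exact (R x).val_congr (Category.comp_id f) trivial

/-- A cone of parameter objects of universal families carries a family indexed by the maps that
lower the degree. -/
def coneFamily (t : Cone F) : MonotoneFamily c (D.degLT (D.deg i)) i t.pt where
  val f hj := t.π.app (D.matchingIndex f hj) ≫ (R _).val (𝟙 _) trivial
  entails f g hj hk := by
    refine (congrArg (c.Entails _) (cone_π_val R hF t (D.matchingIndex f hj) g hk)).mpr ?_
    exact ((R (D.matchingIndex f hj)).entails_id g).precomp _

lemma coneFamily_val (t : Cone F) {j : I} (f : i ⟶ j) (hj : D.degLT (D.deg i) j) :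
    (coneFamily R hF t).val f hj =
      t.π.app (D.matchingIndex f hj) ≫ (R _).val (𝟙 _) trivial := rfl

/-- The cone induced by a family indexed by the maps that lower the degree. -/
@[simps]
def familyCone {A : E} (s : MonotoneFamily c (D.degLT (D.deg i)) i A) : Cone F where
  pt := A
  π :=
    { app x := (R x).lift (s.pushLT (D.matchingArrow x) (D.deg_right_lt x))
      naturality x y φ := (R y).hom_ext fun f hj => by
        simp only [Functor.const_obj_obj, Functor.const_obj_map, Category.id_comp]
        rw [Category.assoc, hF, (R y).fac, (R x).fac]
        exact s.val_congr (by simp [← D.matchingArrow_comp φ]) _ }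

/-- A limit of parameter objects of universal families is universal for families indexed by the
maps that lower the degree. -/
def universalFamilyOfIsLimit {t : Cone F} (ht : IsLimit t) :
    UniversalFamily c (D.degLT (D.deg i)) i t.pt where
  toMonotoneFamily := coneFamily R hF t
  lift s := ht.lift (familyCone R hF s)
  fac {A} s {j} f hj := by
    have h := ht.fac (familyCone R hF s) (D.matchingIndex f hj)
    exact (Category.assoc _ _ _).symm.trans <| (congrArg (· ≫ (R _).val (𝟙 _) trivial) h).trans <|
      ((R _).fac _ _ _).trans (s.val_congr (Category.comp_id f) hj)
  hom_ext {A a b} h := ht.hom_ext fun x => (R x).hom_ext fun {k} f hf => by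
    have hk : D.degLT (D.deg i) k := (D.deg_le f).trans_lt (D.deg_right_lt x)
    have := h (D.matchingArrow x ≫ f) hk
    simpa only [coneFamily_val, cone_π_val R hF, Category.assoc] using this

end Limit

/-! ### Full families as an equaliser. -/

section Equalizer

variable {i : I} {M : E} (V : UniversalFamily c (D.degLT (D.deg i)) i M)

/-- A truth value entails the characteristic map of the point `τ` that classifies the constantly
true family if and only if it entails all members of the family. -/
lemma entails_χ_iff [HasPullbacks E] {τ : c.Ω₀ ⟶ M}
    (hτ : ∀ {j : I} (f : i ⟶ j) (hj), τ ≫ V.val f hj = c.truth) {A : E} (u : A ⟶ c.Ω)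
    (m : A ⟶ M) :
    c.Entails u (m ≫ c.χ τ) ↔
      ∀ {j : I} (f : i ⟶ j) (hj), c.Entails u (m ≫ V.val f hj) := by
  constructor
  · intro H j f hj B h hu
    have h' := H h hu
    rw [← Category.assoc, c.comp_χ_eq_top_iff] at h'
    obtain ⟨l, hl⟩ := h'
    rw [← Category.assoc, ← hl, Category.assoc, hτ, c.comp_truth]
  · intro H B h hu
    rw [← Category.assoc, c.comp_χ_eq_top_iff]
    -- Over `B` all members are true, so `h ≫ m` and the point `τ` classify the same family.
    refine ⟨c.χ₀ B, V.hom_ext fun f hj => ?_⟩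
    rw [Category.assoc, hτ, c.comp_truth, Category.assoc, H f hj h hu]

variable [HasFiniteLimits E] {τ : c.Ω₀ ⟶ M}
  (hτ : ∀ {j : I} (f : i ⟶ j) (hj), τ ≫ V.val f hj = c.truth)

variable (τ) in
/-- The map that meets the first component with the characteristic map of the second one. -/
noncomputable abbrev meetχ : c.Ω ⨯ M ⟶ c.Ω := prod.map (𝟙 c.Ω) (c.χ τ) ≫ meet c

/-- The full family induced by a map that equalises the first projection and the meet. -/
@[simps!]
noncomputable def amalgam {A : E} (a : A ⟶ c.Ω ⨯ M) (ha : a ≫ prod.fst = a ≫ meetχ τ) :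
    MonotoneFamily c ⊤ i A :=
  .extend (a ≫ prod.fst) (V.toMonotoneFamily.precomp (a ≫ prod.snd)) fun f hj =>
    (entails_χ_iff V hτ _ (a ≫ prod.snd)).1
      (by simpa using (Subobject.Classifier.eq_comp_meet_iff a (c.χ τ)).1 ha) f hj

/-- The map to the product that is induced by a full family. -/
noncomputable def pairing {A : E} (s : MonotoneFamily c ⊤ i A) : A ⟶ c.Ω ⨯ M :=
  prod.lift (s.val (𝟙 i) trivial) (V.lift (s.restrict _))

include hτ in
lemma pairing_condition {A : E} (s : MonotoneFamily c ⊤ i A) :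
    pairing V s ≫ prod.fst = pairing V s ≫ meetχ τ := by
  rw [Subobject.Classifier.eq_comp_meet_iff, ← Category.assoc]
  refine (entails_χ_iff V hτ _ _).2 fun f hj => ?_
  simpa [pairing, prod.lift_fst, prod.lift_snd, V.fac] using s.entails_id f

/-- Nothing is lost: a map that does not lower the degree is an isomorphism, where the value is that
at `𝟙 i`. -/
lemma amalgam_pairing {A : E} (s : MonotoneFamily c ⊤ i A) :
    amalgam V hτ (pairing V s) (pairing_condition V hτ s) = s := by
  ext j f hj
  by_cases h : D.degLT (D.deg i) j
  · simp [h, pairing, prod.lift_snd_assoc, V.fac]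
  · have := D.isIso_of_deg_le f (not_lt.1 h)
    simp [h, pairing, prod.lift_fst, s.val_eq_of_isIso f]

lemma pairing_amalgam {A : E} (a : A ⟶ c.Ω ⨯ M) (ha : a ≫ prod.fst = a ≫ meetχ τ) :
    pairing V (amalgam V hτ a ha) = a := by
  ext
  · simpa [pairing, prod.lift_fst] using fun h => absurd h (D.not_degLT_self i)
  · refine V.hom_ext fun {j} f hj => ?_
    simp [pairing, prod.lift_snd, V.fac, hj]

lemma pairing_precomp {A B : E} (s : MonotoneFamily c ⊤ i A) (b : B ⟶ A) :
    pairing V (s.precomp b) = b ≫ pairing V s := by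
  ext
  · simp [pairing, prod.lift_fst]
  · refine V.hom_ext fun {j} f hj => ?_
    simp [pairing, prod.lift_snd, V.fac]

/-- The equaliser of the first projection and the meet is the parameter object of a universal
full family. -/
noncomputable def universalFamilyEqualizer :
    UniversalFamily c ⊤ i (equalizer prod.fst (meetχ τ)) where
  toMonotoneFamily := amalgam V hτ (equalizer.ι _ _) (equalizer.condition _ _)
  lift s := equalizer.lift (pairing V s) (pairing_condition V hτ s)
  fac {A} s {j} f hj := by
    have h := congrArg (fun s' => s'.val f hj) (amalgam_pairing V hτ s)
    rw [← h]
    by_cases hj : D.degLT (D.deg i) j <;> simp [hj]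
  hom_ext {A a b} h := by
    -- Applying the natural map `pairing V`, which undoes `amalgam`, turns equal families into equal
    -- composites with the equaliser inclusion.
    have key : (amalgam V hτ (equalizer.ι _ _) (equalizer.condition _ _)).precomp a =
        (amalgam V hτ (equalizer.ι _ _) (equalizer.condition _ _)).precomp b := by
      ext j f hj
      exact h f hj
    have := congrArg (pairing V) key
    rw [pairing_precomp, pairing_precomp, pairing_amalgam] at this
    exact equalizer.hom_ext this

/-- If the parameter object of a universal full family is given, then the pairing exhibits it as
an equaliser of the first projection and the meet. -/
noncomputable def isLimitPairing {W : E} (R : UniversalFamily c ⊤ i W) :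
    IsLimit (Fork.ofι (pairing V R.toMonotoneFamily)
      (pairing_condition V hτ R.toMonotoneFamily)) :=
  Fork.IsLimit.mk _ (fun s => R.lift (amalgam V hτ s.ι s.condition))
    (fun s => by
      have h : R.toMonotoneFamily.precomp (R.lift (amalgam V hτ s.ι s.condition)) =
          amalgam V hτ s.ι s.condition := by
        ext j f hj
        exact R.fac _ f hj
      rw [Fork.ι_ofι, ← pairing_precomp, h, pairing_amalgam])
    (fun s a ha => R.hom_ext fun {j} f hj => by
      have h : R.toMonotoneFamily.precomp a = amalgam V hτ s.ι s.condition := by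
        rw [← amalgam_pairing V hτ (R.toMonotoneFamily.precomp a)]
        congr 1
        rw [pairing_precomp]
        exact ha
      rw [R.fac, ← h, MonotoneFamily.precomp_val])

end Equalizer

/-- Universal full families exist at each object. -/
lemma exists_universalFamily (D : GenInverseStructure I) [HasFiniteLimits E]
    [D.HasMatchingLimits E] (c : Subobject.Classifier E) (i : I) :
    ∃ W : E, Nonempty (UniversalFamily c ⊤ i W) := by
  -- No base case is needed: in degree zero the matching shape is empty and its limit is terminal.
  induction h : D.deg i using Nat.strong_induction_on generalizing i with
  | _ n ih =>
    subst h
    have H (x : D.MatchingShape (D.toStratum i)) :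
        ∃ W : E, Nonempty (UniversalFamily c ⊤ x.right.obj W) :=
      ih _ (D.deg_right_lt x) _ rfl
    choose W R' using H
    have R (x) := (R' x).some
    let K : D.MatchingShape (D.toStratum i) ⥤ I :=
      StructuredArrow.proj _ _ ⋙ (D.degLT (D.deg i)).ι
    have hF : ∀ {x y} (φ : x ⟶ y) {k : I} (f : y.right.obj ⟶ k),
        (UniversalFamily.diagram K R).map φ ≫ (R y).val f trivial =
          (R x).val (φ.right.hom ≫ f) trivial :=
      fun {x y} φ {k} f => UniversalFamily.diagram_map_val K R φ f
    have := HasMatchingLimits.hasLimitsOfShape (D := D) (E := E) _ (D.toStratum i)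
    let V := universalFamilyOfIsLimit (F := UniversalFamily.diagram K R) R hF (limit.isLimit _)
    exact ⟨_, ⟨universalFamilyEqualizer V (τ := V.lift (.top c _ i c.Ω₀)) fun f hj => by
      rw [V.fac, MonotoneFamily.top_val, c.top_Ω₀]⟩⟩

/-- There is a diagram of parameter objects of universal full families. -/
lemma exists_universalDiagram (D : GenInverseStructure I) [HasFiniteLimits E]
    [D.HasMatchingLimits E] (c : Subobject.Classifier E) :
    ∃ (Ω : I ⥤ E) (R : ∀ i, UniversalFamily c ⊤ i (Ω.obj i)),
      ∀ {i j k : I} (g : i ⟶ j) (f : j ⟶ k),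
        Ω.map g ≫ (R j).val f trivial = (R i).val (g ≫ f) trivial := by
  choose W R using exists_universalFamily D c
  exact ⟨UniversalFamily.diagram (𝟭 I) fun i => (R i).some, fun i => (R i).some,
    fun {i j k} g f => UniversalFamily.diagram_map_val (𝟭 I) (fun i => (R i).some) g f⟩

end InverseDiagram

namespace InverseDiagram

open GenInverseStructure

variable {I : Type u₁} [Category.{v₁} I] {E : Type u₂} [Category.{v₂} E]
  {c : Subobject.Classifier E}

/-! ### The subobject classifier of diagrams. -/

section Diagram

variable {Ω : I ⥤ E} (R : ∀ i, UniversalFamily c ⊤ i (Ω.obj i))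
  (hR : ∀ {i j k : I} (g : i ⟶ j) (f : j ⟶ k),
    Ω.map g ≫ (R j).val f trivial = (R i).val (g ≫ f) trivial)
  (T : I ⥤ E)

/-- The map of diagrams that classifies the constantly true families. -/
def omegaTruth : T ⟶ Ω where
  app i := (R i).lift (.top c ⊤ i (T.obj i))
  naturality i j g := (R j).hom_ext fun f _ => by
    rw [Category.assoc, Category.assoc, hR, (R j).fac, (R i).fac]
    simp

lemma omegaTruth_app_val {i j : I} (f : i ⟶ j) :
    (omegaTruth R hR T).app i ≫ (R i).val f trivial = c.top (T.obj i) :=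
  (R i).fac _ f _

/-- The value at the identity entails all others, so its truth makes the whole family constantly
true. -/
lemma eq_comp_omegaTruth_app_iff {i : I} {A : E} (a : A ⟶ Ω.obj i) (k : A ⟶ T.obj i) :
    a = k ≫ (omegaTruth R hR T).app i ↔ a ≫ (R i).val (𝟙 i) trivial = c.top A := by
  constructor
  · intro h
    rw [h, Category.assoc, omegaTruth_app_val, c.comp_top]
  · intro h
    refine (R i).hom_ext fun f _ => ?_
    rw [Category.assoc, omegaTruth_app_val, c.comp_top]
    exact (R i).entails_id f a h

/-- The family of the characteristic maps of the components of a monomorphism of diagrams. -/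
@[simps]
def charFamily {U X : I ⥤ E} (m : U ⟶ X) [∀ i, Mono (m.app i)] (i : I) :
    MonotoneFamily c ⊤ i (X.obj i) where
  val {j} f _ := X.map f ≫ c.χ (m.app j)
  entails {j k} f g _ _ := by
    intro B h hs
    rw [← Category.assoc, c.comp_χ_eq_top_iff] at hs ⊢
    obtain ⟨l, hl⟩ := hs
    -- A factorisation through `m.app j` is carried along `g` by naturality of `m`.
    exact ⟨l ≫ U.map g, by simp [reassoc_of% hl]⟩

/-- The characteristic map of a monomorphism of diagrams. -/
def omegaχ {U X : I ⥤ E} (m : U ⟶ X) [∀ i, Mono (m.app i)] : X ⟶ Ω where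
  app i := (R i).lift (charFamily m i)
  naturality i j g := (R j).hom_ext fun f hj => by
    rw [Category.assoc, Category.assoc, hR, (R j).fac, (R i).fac]
    simp

lemma omegaχ_app_val {U X : I ⥤ E} (m : U ⟶ X) [∀ i, Mono (m.app i)] {i j : I} (f : i ⟶ j) :
    (omegaχ R hR m).app i ≫ (R i).val f trivial = X.map f ≫ c.χ (m.app j) :=
  (R i).fac _ f _

variable {T} (hT : IsTerminal T) (hT' : ∀ i, IsTerminal (T.obj i))

include hT' in
lemma isPullback_omegaχ [HasPullbacks E] {U X : I ⥤ E} (m : U ⟶ X) [∀ i, Mono (m.app i)] :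
    IsPullback m (hT.from U) (omegaχ R hR m) (omegaTruth R hR T) := by
  refine .of_forall_isPullback_app fun i =>
    Subobject.Classifier.isPullback_of_isTerminal (hT' i) ?_ fun B h w => ?_
  · rw [eq_comp_omegaTruth_app_iff, Category.assoc, omegaχ_app_val, X.map_id,
      Category.id_comp]
    exact (c.comp_χ_eq_top_iff _ _).2 ⟨𝟙 _, Category.id_comp _⟩
  · rw [eq_comp_omegaTruth_app_iff, Category.assoc, omegaχ_app_val, X.map_id,
      Category.id_comp] at w
    exact (c.comp_χ_eq_top_iff _ _).1 w

include hT' in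
-- Pullbacks of diagrams are pointwise, so uniqueness of `χ` in `E` fixes the values at identities;
-- naturality of `x` reduces the value at `f` to the one at `𝟙 j`.
lemma omegaχ_uniq [HasPullbacks E] {U X : I ⥤ E} (m : U ⟶ X) [∀ i, Mono (m.app i)]
    (x : X ⟶ Ω) {k : U ⟶ T} (hx : IsPullback m k x (omegaTruth R hR T)) :
    x = omegaχ R hR m := by
  have key (i : I) : x.app i ≫ (R i).val (𝟙 i) trivial = c.χ (m.app i) := by
    have h := hx.app i
    refine c.uniq _ (χ₀' := c.χ₀ _)
      (Subobject.Classifier.isPullback_of_isTerminal c.isTerminalΩ₀ ?_ fun B a w => ?_)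
    · rw [← Category.assoc]
      exact (eq_comp_omegaTruth_app_iff R hR T _ _).1 h.w
    · rw [← Category.assoc] at w
      exact ⟨h.lift a ((hT' i).from B) ((eq_comp_omegaTruth_app_iff R hR T _ _).2 w),
        h.lift_fst _ _ _⟩
  ext i
  refine (R i).hom_ext fun {j} f _ => ?_
  have h := hR f (𝟙 j)
  rw [Category.comp_id] at h
  rw [omegaχ_app_val, ← key, ← Category.assoc, x.naturality, Category.assoc, h]

end Diagram

/-- There is a subobject classifier of diagrams whose object of truth values consists of parameter
objects of universal full families, and whose truth map classifies the constantly true families. -/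
lemma exists_classifier [HasFiniteLimits E] (D : GenInverseStructure I) [D.HasMatchingLimits E]
    (c : Subobject.Classifier E) :
    ∃ (d : Subobject.Classifier (I ⥤ E)) (R : ∀ i, UniversalFamily c ⊤ i (d.Ω.obj i)),
      (∀ {i j k : I} (g : i ⟶ j) (f : j ⟶ k),
        d.Ω.map g ≫ (R j).val f trivial = (R i).val (g ≫ f) trivial) ∧
      ∀ {i j : I} (f : i ⟶ j),
        d.truth.app i ≫ (R i).val f trivial = c.top (d.Ω₀.obj i) := by
  obtain ⟨Ω, R, hR⟩ := exists_universalDiagram D c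
  have hT' (i : I) : IsTerminal ((⊤_ (I ⥤ E)).obj i) :=
    IsTerminal.isTerminalObj ((evaluation I E).obj i) _ terminalIsTerminal
  exact ⟨.mkOfTerminalΩ₀ _ terminalIsTerminal Ω (omegaTruth R hR _)
    (fun m _ => omegaχ R hR m) (fun m _ => isPullback_omegaχ R hR terminalIsTerminal hT' m)
    (fun m _ x hx => omegaχ_uniq R hR hT' m x hx), R, hR, fun f => omegaTruth_app_val R hR _ f⟩

/-! ### Matching objects as limits, computed from the Kan extension. -/

section Matching

variable (D : GenInverseStructure I) [D.HasMatchingLimits E]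

/-- The restriction of a diagram to the indices of the matching limit. -/
abbrev matchingDiagram (X : I ⥤ E) (i : I) : D.MatchingShape (D.toStratum i) ⥤ E :=
  StructuredArrow.proj _ _ ⋙ D.inclLT (D.deg i) ⋙ (D.degLE (D.deg i)).ι ⋙ X

/-- The projections of the matching object. -/
noncomputable def matchingProj (X : I ⥤ E) (i : I) (x : D.MatchingShape (D.toStratum i)) :
    (D.matchingObj E i).obj X ⟶ X.obj x.right.obj :=
  ((D.inclLT (D.deg i)).ran.obj (D.inclLT (D.deg i) ⋙ (D.degLE (D.deg i)).ι ⋙ X)).map x.hom ≫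
    ((D.inclLT (D.deg i)).ranCounit.app
      (D.inclLT (D.deg i) ⋙ (D.degLE (D.deg i)).ι ⋙ X)).app x.right

/-- The matching object as a cone. -/
noncomputable def matchingCone (X : I ⥤ E) (i : I) : Cone (matchingDiagram D X i) where
  pt := (D.matchingObj E i).obj X
  π :=
    { app := matchingProj D X i
      naturality := (Functor.RightExtension.coneAt (.mk _ ((D.inclLT (D.deg i)).ranCounit.app
        (D.inclLT (D.deg i) ⋙ (D.degLE (D.deg i)).ι ⋙ X)))
        ((D.inclStratum (D.deg i)).obj (D.toStratum i))).π.naturality }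

/-- The matching object is a limit. -/
noncomputable def isLimitMatchingCone (X : I ⥤ E) (i : I) : IsLimit (matchingCone D X i) :=
  (D.inclLT (D.deg i)).isPointwiseRightKanExtensionRanCounit
    (D.inclLT (D.deg i) ⋙ (D.degLE (D.deg i)).ι ⋙ X) _

/-- Naturality of the unit at `x.hom` moves the projection to an object of lower degree, where a
triangle identity cancels unit against counit. -/
lemma matchingMap_proj (X : I ⥤ E) (i : I) (x : D.MatchingShape (D.toStratum i)) :
    D.matchingMap X i ≫ matchingProj D X i x = X.map (D.matchingArrow x) := by
  let L := D.inclLT (D.deg i)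
  let Y := (D.degLE (D.deg i)).ι ⋙ X
  have h := L.ranCounit_app_app_ranAdjunction_unit_app_app Y x.right
  have h' := ((L.ranAdjunction E).unit.app Y).naturality x.hom
  change ((L.ranAdjunction E).unit.app Y).app _ ≫ (L.ran.obj (L ⋙ Y)).map x.hom ≫
    (L.ranCounit.app (L ⋙ Y)).app x.right = Y.map x.hom
  refine (Category.assoc _ _ _).symm.trans ?_
  refine (congrArg (· ≫ (L.ranCounit.app (L ⋙ Y)).app x.right) h'.symm).trans ?_
  refine (Category.assoc _ _ _).trans ?_
  exact (congrArg (Y.map x.hom ≫ ·) h).trans (Category.comp_id _)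

lemma matchingObj_map_proj {X Y : I ⥤ E} (α : X ⟶ Y) (i : I)
    (x : D.MatchingShape (D.toStratum i)) :
    (D.matchingObj E i).map α ≫ matchingProj D Y i x =
      matchingProj D X i x ≫ α.app x.right.obj := by
  let L := D.inclLT (D.deg i)
  let β := Functor.whiskerLeft L (Functor.whiskerLeft (D.degLE (D.deg i)).ι α)
  have h := congr_app (L.ranCounit.naturality β) x.right
  have h' := (L.ran.map β).naturality x.hom
  change (L.ran.map β).app _ ≫ (L.ran.obj _).map x.hom ≫ (L.ranCounit.app _).app x.right =
    ((L.ran.obj _).map x.hom ≫ (L.ranCounit.app _).app x.right) ≫ β.app x.right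
  refine (Category.assoc _ _ _).symm.trans ?_
  refine (congrArg (· ≫ (L.ranCounit.app _).app x.right) h'.symm).trans ?_
  refine (Category.assoc _ _ _).trans ?_
  exact (congrArg ((L.ran.obj _).map x.hom ≫ ·) h).trans (Category.assoc _ _ _).symm

variable {Ω : I ⥤ E} (R : ∀ i, UniversalFamily c ⊤ i (Ω.obj i))
  (hR : ∀ {i j k : I} (g : i ⟶ j) (f : j ⟶ k),
    Ω.map g ≫ (R j).val f trivial = (R i).val (g ≫ f) trivial)

/-- The matching object of the diagram of truth values is universal for families indexed by the
maps that lower the degree. -/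
noncomputable def universalFamilyMatchingObj (i : I) :
    UniversalFamily c (D.degLT (D.deg i)) i ((D.matchingObj E i).obj Ω) :=
  universalFamilyOfIsLimit (F := matchingDiagram D Ω i) (fun x => R x.right.obj)
    (fun {_ _} φ {_} f => hR (InducedCategory.Hom.hom (StructuredArrow.Hom.right φ)) f)
    (isLimitMatchingCone D Ω i)

lemma universalFamilyMatchingObj_val (i : I) {j : I} (f : i ⟶ j) (hj : D.degLT (D.deg i) j) :
    (universalFamilyMatchingObj D R hR i).val f hj =
      matchingProj D Ω i (D.matchingIndex f hj) ≫ (R j).val (𝟙 j) trivial := rfl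

/-- This identifies the second component of `pairing` with the matching map. -/
lemma matchingMap_eq (i : I) :
    D.matchingMap Ω i =
      (universalFamilyMatchingObj D R hR i).lift ((R i).restrict _) := by
  refine (universalFamilyMatchingObj D R hR i).hom_ext fun {j} f hj => ?_
  rw [(universalFamilyMatchingObj D R hR i).fac, universalFamilyMatchingObj_val]
  have h := matchingMap_proj D Ω i (D.matchingIndex f hj)
  refine (Category.assoc _ _ _).symm.trans ?_
  refine (congrArg (· ≫ (R j).val (𝟙 j) trivial) h).trans ?_
  exact (hR f (𝟙 j)).trans ((R i).val_congr (Category.comp_id f) trivial)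

end Matching

/-! ### The truth map and its image in the matching object. -/

section Truth

variable [HasFiniteLimits E] (d : Subobject.Classifier (I ⥤ E))
  (R : ∀ i, UniversalFamily c ⊤ i (d.Ω.obj i))
  (hd : ∀ {i j : I} (f : i ⟶ j), d.truth.app i ≫ (R i).val f trivial = c.top (d.Ω₀.obj i))

include hd in
lemma truthAt_val {i j : I} (f : i ⟶ j) :
    truthAt c d i ≫ (R i).val f trivial = c.truth := by
  rw [truthAt, Category.assoc, hd]
  exact (c.comp_top _).trans c.top_Ω₀

variable (D : GenInverseStructure I) [D.HasMatchingLimits E]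
  (hR : ∀ {i j k : I} (g : i ⟶ j) (f : j ⟶ k),
    d.Ω.map g ≫ (R j).val f trivial = (R i).val (g ≫ f) trivial)

include hd in
-- This provides the hypothesis `hτ` of the equaliser construction for the point `M_i(true)`.
lemma matchingTruth_val (i : I) {j : I} (f : i ⟶ j) (hj : D.degLT (D.deg i) j) :
    matchingTruth D c d i ≫ (universalFamilyMatchingObj D R hR i).val f hj = c.truth := by
  have h := matchingObj_map_proj D d.truth i (D.matchingIndex f hj)
  have h' : matchingProj D d.Ω₀ i (D.matchingIndex f hj) ≫ d.truth.app _ ≫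
      (R _).val (𝟙 (D.matchingIndex f hj).right.obj) trivial = c.top _ := by
    rw [hd (𝟙 _)]
    exact c.comp_top _
  rw [universalFamilyMatchingObj_val, matchingTruth, Category.assoc, ← c.top_Ω₀,
    ← c.comp_top ((D.isTerminalMatchingObj i d.isTerminalΩ₀).from c.Ω₀), ← h']
  congr 1
  exact (Category.assoc _ _ _).symm.trans <|
    (congrArg (· ≫ (R j).val (𝟙 j) trivial) h).trans (Category.assoc _ _ _)

end Truth

end InverseDiagram

theorem mainTheorem8 {I : Type u₁} [Category.{v₁} I] (D : GenInverseStructure I)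
    {E : Type u₂} [Category.{v₂} E] [HasFiniteLimits E] [D.HasMatchingLimits E]
    (hE : (∀ n : ℕ, CategoryTheory.IsPreconnected (D.Stratum n)) ∨ HasInitial E)
    (c : Subobject.Classifier E) :
    ∃ d : Subobject.Classifier (I ⥤ E), ∀ i : I,
      ∃ (e : d.Ω.obj i ⟶ c.Ω ⨯ (D.matchingObj E i).obj d.Ω)
        (w : e ≫ prod.fst =
          e ≫ prod.map (𝟙 c.Ω) (c.χ (InverseDiagram.matchingTruth D c d i)) ≫
            InverseDiagram.meet c),
        Nonempty (IsLimit (Fork.ofι e w)) ∧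
        e ≫ prod.snd = D.matchingMap d.Ω i ∧
        InverseDiagram.truthAt c d i ≫ e ≫ prod.fst = c.truth ∧
        InverseDiagram.truthAt c d i ≫ e ≫ prod.snd = InverseDiagram.matchingTruth D c d i := by
  obtain ⟨d, R, hR, hd⟩ := InverseDiagram.exists_classifier D c
  refine ⟨d, fun i => ?_⟩
  let V := InverseDiagram.universalFamilyMatchingObj D R hR i
  have hτ {j : I} (f : i ⟶ j) (hj : D.degLT (D.deg i) j) :
      InverseDiagram.matchingTruth D c d i ≫ V.val f hj = c.truth :=
    InverseDiagram.matchingTruth_val d R hd D hR i f hj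
  refine ⟨InverseDiagram.pairing V (R i).toMonotoneFamily,
    InverseDiagram.pairing_condition V hτ _, ⟨InverseDiagram.isLimitPairing V hτ (R i)⟩,
    ?_, ?_, ?_⟩
  · exact (prod.lift_snd _ _).trans (InverseDiagram.matchingMap_eq D R hR i).symm
  · rw [InverseDiagram.pairing, prod.lift_fst]
    exact InverseDiagram.truthAt_val d R hd (𝟙 i)
  · rw [InverseDiagram.pairing, prod.lift_snd]
    -- Both points of the matching object classify the constantly true family.
    refine V.hom_ext fun f hj => ?_
    rw [Category.assoc, V.fac, hτ]
    exact InverseDiagram.truthAt_val d R hd f
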